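/- Let $r\ge 0$, and for $1\le i\le r$ let $M_i$ be a smooth Riemannian manifold of dimension $n_i\ge 2$ (without boundary) and $f_i\colon M_i\to\mathbb R^{m_i}$ a smooth isometric immersion. Let $M=M_1\times\cdots\times M_r$ carry the Riemannian product metric, let $\mathbb R^m=\mathbb R^{m_1}\oplus\cdots\oplus\mathbb R^{m_r}$ (orthogonal sum), and let $f\colon M\to\mathbb R^m$, $f(x)=(f_1(x_1),\dots,f_r(x_r))$, be the extrinsic product of the $f_i$. Write $\nabla$ for the Levi-Civita connection of $M$, $\tilde\nabla$ for that of Euclidean space, $N_fM(x)=(f_*T_xM)^\perp$ for the normal spaces and $\alpha(X,Y)=(\tilde\nabla_Xf_*Y)_{N_fM}$ for the second fundamental form of $f$. Assume that $f$ has full first normal spaces, i.e. $\operatorname{span}\{\alpha(X,Y):X,Y\in T_xM\}=N_fM(x)$ for every $x\in M$. An infinitesimal bending of an isometric immersion $h\colon N\to\mathbb R^k$ is a smooth section $\mathcal S$ of $h^*T\mathbb R^k$ (that is, a smooth map $N\to\mathbb R^k$) with $\langle\tilde\nabla_X\mathcal S,h_*Y\rangle+\langle h_*X,\tilde\nabla_Y\mathcal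 S\rangle=0$ for all tangent vectors $X,Y$ at the same point; it is trivial if $\mathcal S=\mathcal D h+v$ for a skew-symmetric endomorphism $\mathcal D$ of $\mathbb R^k$ and a vector $v\in\mathbb R^k$. Let $\mathcal T$ be an infinitesimal bending of $f$, and let $\beta(X,Y)=\bigl(\tilde\nabla_X\tilde\nabla_Y\mathcal T-\tilde\nabla_{\nabla_XY}\mathcal T\bigr)_{N_fM}$ be its associated tensor. Assume that $\beta$ is adapted to the product structure: $\beta(X,Y)=0$ at every point of $M$ whenever $X$ is tangent to the factor $M_i$ and $Y$ is tangent to the factor $M_j$ with $i\ne j$. Then $\mathcal T$ is locally a sum of infinitesimal bendings of the factors, up to a trivial one: every point $x^0\in M$ has a neighbourhood $U_1\times\cdots\times U_r$, with $U_i\subset M_i$ open, on which there are infinitesimal bendings $\mathcal T_i\colon U_i\to\mathbb R^{m_i}$ of $f_i|_{U_i}$, a skew-symmetric endomorphism $\mathcal D$ of $\mathbb R^m$ and a vector $v\in\mathbb R^m$ such that $$\mathcal T(x)=(\mathcal T_1(x_1),\dots,\mathcal T_r(x_r))+\mathcal D f(x)+v\qquad\text{for all }x\in U_1\times\cdots\times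 U_r .$$ -/

import Mathlib

open Set Bundle
open scoped Manifold ContDiff InnerProductSpace

noncomputable section

namespace InfBending

section General

variable {E : Type*} [NormedAddCommGroup E] [NormedSpace ℝ E]
  {H : Type*} [TopologicalSpace H] (I : ModelWithCorners ℝ E H)
  {M : Type*} [TopologicalSpace M] [ChartedSpace H M]
  {V : Type*} [NormedAddCommGroup V] [InnerProductSpace ℝ V] [FiniteDimensional ℝ V]

/-- The differential `u_* : T_x M → V` of a map `u : M → V` into a Euclidean space. For a section
`𝓣` of `f^*TV`, viewed as a map `M → V`, this is `X ↦ ∇̃_X 𝓣`. -/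
def diff (u : M → V) (x : M) : E →L[ℝ] V := mfderiv I 𝓘(ℝ, V) u x

/-- `f` is a smooth isometric immersion of `M`, with Riemannian metric `g`, into `V`. -/
structure IsIsometricImmersion (g : ∀ x : M, TangentSpace I x → TangentSpace I x → ℝ)
    (f : M → V) : Prop where
  smooth : ContMDiff I 𝓘(ℝ, V) ∞ f
  isometric : ∀ (x : M) (X Y : TangentSpace I x),
    ⟪diff I f x X, diff I f x Y⟫_ℝ = g x X Y

/-- `T` is a (smooth) infinitesimal bending of the restriction of `f` to the open set `U`. -/
structure IsInfinitesimalBendingOn (f T : M → V) (U : Set M) : Prop where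
  isOpen : IsOpen U
  smooth : ContMDiffOn I 𝓘(ℝ, V) ∞ T U
  bending : ∀ x ∈ U, ∀ X Y : TangentSpace I x,
    ⟪diff I T x X, diff I f x Y⟫_ℝ + ⟪diff I f x X, diff I T x Y⟫_ℝ = 0

/-- `T` is a trivial infinitesimal bending of `f` on `U`: the restriction along `f` of a Killing
field `y ↦ D y + v` of the ambient Euclidean space, with `D` skew-symmetric. -/
def IsTrivialBendingOn (f T : M → V) (U : Set M) : Prop :=
  ∃ (D : V →ₗ[ℝ] V) (v : V), (∀ y z : V, ⟪D y, z⟫_ℝ = -⟪y, D z⟫_ℝ) ∧ ∀ x ∈ U, T x = D (f x) + v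

/-- The coefficients `g_{ab}(y) = g(∂_a, ∂_b)` of the metric `g` in the chart at `x`; here `y` is a
point of the target of that chart, and `a`, `b` are constant coordinate vector fields. -/
def chartMetric (g : ∀ x : M, TangentSpace I x → TangentSpace I x → ℝ) (x : M) (y a b : E) : ℝ :=
  g ((extChartAt I x).symm y)
    (mfderiv 𝓘(ℝ, E) I (extChartAt I x).symm y a)
    (mfderiv 𝓘(ℝ, E) I (extChartAt I x).symm y b)

/-- The derivative `∂_a g_{bc}` at `x` of the metric coefficients in the chart at `x`. -/
def chartMetricDeriv (g : ∀ x : M, TangentSpace I x → TangentSpace I x → ℝ) (x : M)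
    (a b c : E) : ℝ :=
  fderiv ℝ (fun y => chartMetric I g x y b c) (extChartAt I x x) a

/-- The Christoffel symbol of the Levi-Civita connection of `g` at `x`, in the chart at `x`:
`Γ(a, b) = ∇_{∂_a} ∂_b` is the unique vector with
`g(Γ(a, b), c) = (∂_a g_{bc} + ∂_b g_{ac} - ∂_c g_{ab}) / 2` for all `c`. -/
def christoffel (g : ∀ x : M, TangentSpace I x → TangentSpace I x → ℝ) (x : M) (a b : E) : E :=
  Classical.epsilon fun w : E => ∀ c : E,
    chartMetric I g x (extChartAt I x x) w c =
      (chartMetricDeriv I g x a b c + chartMetricDeriv I g x b a c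
        - chartMetricDeriv I g x c a b) / 2

/-- The Hessian of a map `u : M → V` with respect to the Levi-Civita connection `∇` of `g`,
`(X, Y) ↦ ∇̃_X (u_* Y) - u_* ∇_X Y`, written in the chart at `x`: it is
`∂_a ∂_b u - u_* Γ(a, b)`. (The tangent space `T_x M` is identified with `E` through the chart
at `x`, and the tensor is evaluated on the extensions of `X`, `Y` by constant coordinate vector
fields.) For `u = 𝓣` this is the tensor `B(X, Y) = (∇̃_X L) Y` with `L X = ∇̃_X 𝓣`. -/
def hessian (g : ∀ x : M, TangentSpace I x → TangentSpace I x → ℝ) (u : M → V) (x : M)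
    (X Y : TangentSpace I x) : V :=
  fderiv ℝ (fun y : E => fderiv ℝ (u ∘ (extChartAt I x).symm) y) (extChartAt I x x) X Y
    - diff I u x (christoffel I g x X Y)

/-- The normal space `N_f M(x)`, the orthogonal complement of `f_* T_x M`. -/
def normalSpace (f : M → V) (x : M) : Submodule ℝ V := (diff I f x).rangeᗮ

/-- The second fundamental form `α` of `f`: the normal component of `∇̃_X f_* Y`, or equivalently
of `∇̃_X f_* Y - f_* ∇_X Y`. -/
def secondFundamentalForm (g : ∀ x : M, TangentSpace I x → TangentSpace I x → ℝ) (f : M → V)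
    (x : M) (X Y : TangentSpace I x) : V :=
  (normalSpace I f x).starProjection (hessian I g f x X Y)

/-- `f` has full first normal space at `x`: the vectors `α(X, Y)` span the normal space. -/
def HasFullFirstNormalSpace (g : ∀ x : M, TangentSpace I x → TangentSpace I x → ℝ) (f : M → V)
    (x : M) : Prop :=
  Submodule.span ℝ {w : V | ∃ X Y : TangentSpace I x, w = secondFundamentalForm I g f x X Y} =
    normalSpace I f x

/-- The tensor `β` associated to an infinitesimal bending `T` of `f`: the normal component of
`B(X, Y) = ∇̃_X (L Y) - L ∇_X Y`, where `L X = ∇̃_X T`. -/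
def bendingTensor (g : ∀ x : M, TangentSpace I x → TangentSpace I x → ℝ) (f T : M → V)
    (x : M) (X Y : TangentSpace I x) : V :=
  (normalSpace I f x).starProjection (hessian I g T x X Y)

end General

section Product

variable {r : ℕ} {n m : Fin r → ℕ}
  {M : Fin r → Type*} [∀ i, TopologicalSpace (M i)]
  [∀ i, ChartedSpace (EuclideanSpace ℝ (Fin (n i))) (M i)]

/-- The model with corners of a product manifold `M_1 × ⋯ × M_r` with `dim M_i = n_i`. -/
abbrev prodModel (n : Fin r → ℕ) :
    ModelWithCorners ℝ (∀ i, EuclideanSpace ℝ (Fin (n i)))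
      (ModelPi fun i => EuclideanSpace ℝ (Fin (n i))) :=
  ModelWithCorners.pi fun i => 𝓡 (n i)

/-- The Euclidean space `ℝ^m = ℝ^{m_1} ⊕ ⋯ ⊕ ℝ^{m_r}` (orthogonal direct sum). -/
abbrev Ambient (m : Fin r → ℕ) : Type := PiLp 2 fun i => EuclideanSpace ℝ (Fin (m i))

/-- The tangent vector `ι_{i*} X` of `M_1 × ⋯ × M_r` at `x`, for `X` tangent to `M_i` at `x_i`. -/
def inclTangent (x : ∀ i, M i) (i : Fin r) (X : TangentSpace (𝓡 (n i)) (x i)) :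
    TangentSpace (prodModel n) x :=
  (Pi.single i X : ∀ k, EuclideanSpace ℝ (Fin (n k)))

/-- The Riemannian product metric on `M_1 × ⋯ × M_r`. -/
def prodMetric [∀ i, IsManifold (𝓡 (n i)) ∞ (M i)]
    (g : ∀ i, ContMDiffRiemannianMetric (𝓡 (n i)) ∞ (EuclideanSpace ℝ (Fin (n i)))
      (fun x : M i => TangentSpace (𝓡 (n i)) x))
    (x : ∀ i, M i) (X Y : TangentSpace (prodModel n) x) : ℝ :=
  ∑ i, (g i).inner (x i) ((X : ∀ k, EuclideanSpace ℝ (Fin (n k))) i)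
    ((Y : ∀ k, EuclideanSpace ℝ (Fin (n k))) i)

/-- The extrinsic product `f(x) = (f_1(x_1), …, f_r(x_r))`. -/
def extrinsicProduct (f : ∀ i, M i → EuclideanSpace ℝ (Fin (m i))) (x : ∀ i, M i) : Ambient m :=
  WithLp.toLp 2 fun i => f i (x i)

/-- The tensor `β` of a bending `T` of `f : M_1 × ⋯ × M_r → V` is adapted to the product
structure: `β(ι_{i*} X, ι_{j*} Y) = 0` for `i ≠ j`. -/
def IsAdapted {V : Type*} [NormedAddCommGroup V] [InnerProductSpace ℝ V] [FiniteDimensional ℝ V]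
    (g : ∀ x : (∀ i, M i), TangentSpace (prodModel n) x → TangentSpace (prodModel n) x → ℝ)
    (f T : (∀ i, M i) → V) : Prop :=
  ∀ (x : ∀ i, M i) (i j : Fin r), i ≠ j →
    ∀ (X : TangentSpace (𝓡 (n i)) (x i)) (Y : TangentSpace (𝓡 (n j)) (x j)),
      bendingTensor (prodModel n) g f T x (inclTangent x i X) (inclTangent x j Y) = 0

end Product

end InfBending

end

/-!
Let `f_* c` and `T_* c` denote derivatives along `c`, and let `a`, `b` be tangent to different
factors. In product charts `∂_a ∂_b f = 0`, so `∇_a b = 0` and `β(a, b) = 0` says that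
`∂_a ∂_b T` is tangent to `f`. Differentiating the bending equation gives
`⟪∂_a ∂_b T, f_* c⟫ = -⟪∂_a ∂_b f, T_* c⟫ = 0`, so `∂_a ∂_b T = 0`. Hence on a product of connected
open sets `T x - T x₀` is a sum `∑ i, S_i (x_i)` of increments of `T` along the factors.

Let `F_i` be the increments of `f` along the `i`-th factor; they take values in `ℝ^{m_i}`.
Integrating the bending equation over two different factors gives `⟪S_i, F_j⟫ + ⟪F_i, S_j⟫ = 0` for
`i ≠ j`. So the assignment `F_i(p) ↦ S_i(p) - S_i(p)_i`, where the component in `ℝ^{m_i}` is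
removed, is skew-symmetric. Full first normal spaces keep the image of `f` out of every proper
affine subspace, the vectors `F_i(p)` therefore span, and a skew-symmetric assignment on a spanning
family extends to a skew-symmetric endomorphism `D`. What remains of `T` after subtracting `D f` and
a constant is the sum of the components `S_i(p)_i`, and these are infinitesimal bendings of the
factors.
-/

noncomputable section

namespace InfBending

section PiManifold

variable {ι : Type*} [Fintype ι] {E H : ι → Type*} [∀ i, NormedAddCommGroup (E i)]
  [∀ i, NormedSpace ℝ (E i)] [∀ i, TopologicalSpace (H i)]
  {I : ∀ i, ModelWithCorners ℝ (E i) (H i)} {M : ι → Type*}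
  [∀ i, TopologicalSpace (M i)] [∀ i, ChartedSpace (H i) (M i)]

instance isManifold_pi {k : ℕ∞ω} [∀ i, IsManifold (I i) k (M i)] :
    IsManifold (ModelWithCorners.pi I) k (∀ i, M i) := by
  refine isManifold_of_contDiffOn _ _ _ ?_
  rintro _ _ ⟨e, he, rfl⟩ ⟨e', he', rfl⟩
  refine contDiffOn_pi.2 fun i => ?_
  have h := (contDiffGroupoid k (I i)).compatible (he i trivial) (he' i trivial)
  refine ContDiffOn.comp (g := (I i) ∘ ((e i).symm ≫ₕ e' i) ∘ (I i).symm)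
    (t := (I i).symm ⁻¹' ((e i).symm ≫ₕ e' i).source ∩ range (I i))
    h.1 (ContinuousLinearMap.proj (R := ℝ) (φ := E) i).contDiff.contDiffOn ?_
  rintro y ⟨⟨hy1, hy2⟩, z, rfl⟩
  exact ⟨⟨hy1 i trivial, hy2 i trivial⟩, z i, rfl⟩

lemma range_modelWithCorners_pi : range (ModelWithCorners.pi I) = univ.pi fun i => range (I i) :=
  range_piMap fun i => I i

instance boundaryless_pi [∀ i, (I i).Boundaryless] : (ModelWithCorners.pi I).Boundaryless where
  range_eq_univ := by
    simp only [range_modelWithCorners_pi, ModelWithCorners.range_eq_univ, pi_univ]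

lemma extChartAt_pi_apply (x y : ∀ i, M i) (i : ι) :
    extChartAt (ModelWithCorners.pi I) x y i = extChartAt (I i) (x i) (y i) := rfl

lemma extChartAt_pi_symm_apply (x : ∀ i, M i) (z : ∀ i, E i) (i : ι) :
    (extChartAt (ModelWithCorners.pi I) x).symm z i = (extChartAt (I i) (x i)).symm (z i) := rfl

lemma extChartAt_pi_target (x : ∀ i, M i) : (extChartAt (ModelWithCorners.pi I) x).target
    = univ.pi fun i => (extChartAt (I i) (x i)).target := by
  ext z
  simp only [extChartAt_target, mem_inter_iff, mem_preimage, mem_pi, mem_univ, true_imp_iff]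
  rw [range_modelWithCorners_pi, mem_univ_pi, forall_and]
  exact and_congr_left fun _ => mem_univ_pi

variable [∀ i, (I i).Boundaryless]

lemma writtenInExtChartAt_apply (i : ι) (x : ∀ i, M i) :
    writtenInExtChartAt (ModelWithCorners.pi I) (I i) x (fun y : ∀ i, M i => y i)
      =ᶠ[nhds (extChartAt (ModelWithCorners.pi I) x x)] fun z => z i := by
  filter_upwards [extChartAt_target_mem_nhds (I := ModelWithCorners.pi I) x] with z hz
  rw [extChartAt_pi_target] at hz
  exact (extChartAt (I i) (x i)).right_inv (hz i trivial)

lemma contMDiff_apply {k : ℕ∞ω} (i : ι) :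
    ContMDiff (ModelWithCorners.pi I) (I i) k (fun y : ∀ i, M i => y i) := fun x =>
  contMDiffAt_iff.2 ⟨continuousAt_apply i x, ((contDiff_pi.1 contDiff_id i).contDiffAt
    |>.congr_of_eventuallyEq (writtenInExtChartAt_apply i x)).contDiffWithinAt⟩

variable [DecidableEq ι]

lemma writtenInExtChartAt_update (x : ∀ i, M i) (i : ι) (p : M i) :
    writtenInExtChartAt (I i) (ModelWithCorners.pi I) p (Function.update x i)
      =ᶠ[nhds (extChartAt (I i) p p)]
        Function.update (extChartAt (ModelWithCorners.pi I) x x) i := by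
  filter_upwards [extChartAt_target_mem_nhds (I := I i) p] with z hz
  ext1 k
  change extChartAt (I k) (Function.update x i p k)
    (Function.update x i ((extChartAt (I i) p).symm z) k) = _
  rcases eq_or_ne k i with rfl | hk
  · simp only [Function.update_self, (extChartAt (I k) p).right_inv hz]
  · simp only [ne_eq, hk, not_false_eq_true, Function.update_of_ne, extChartAt_pi_apply]

lemma hasMFDerivAt_update (x : ∀ i, M i) (i : ι) (p : M i) :
    HasMFDerivAt (I i) (ModelWithCorners.pi I) (Function.update x i) p
      (ContinuousLinearMap.single ℝ E i) := by
  refine ⟨(continuous_const.update i continuous_id).continuousAt, ?_⟩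
  refine ((HasFDerivAt.congr_fderiv (hasFDerivAt_update _ _) ?_).congr_of_eventuallyEq
    (writtenInExtChartAt_update x i p)).hasFDerivWithinAt
  ext a k
  rcases eq_or_ne k i with rfl | hk
  · simp
  · simp [hk]

lemma contMDiff_update {k : ℕ∞ω} (x : ∀ i, M i) (i : ι) :
    ContMDiff (I i) (ModelWithCorners.pi I) k (Function.update x i) := fun p =>
  contMDiffAt_iff.2 ⟨(continuous_const.update i continuous_id).continuousAt,
    ((contDiff_update k _ i).contDiffAt.congr_of_eventuallyEq
      (writtenInExtChartAt_update x i p)).contDiffWithinAt⟩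

end PiManifold

section Flat

variable {E : Type*} [NormedAddCommGroup E] [NormedSpace ℝ E]

section

variable {V : Type*} [NormedAddCommGroup V] [NormedSpace ℝ V] {u : E → V} {y : E}

lemma hasFDerivAt_fderiv (hu : ContDiffAt ℝ 2 u y) :
    HasFDerivAt (fderiv ℝ u) (fderiv ℝ (fderiv ℝ u) y) y :=
  ((hu.fderiv_right (m := 1) (by norm_num)).differentiableAt (by norm_num)).hasFDerivAt

lemma hasFDerivAt_fderiv_apply (hu : ContDiffAt ℝ 2 u y) (b : E) :
    HasFDerivAt (fun z => fderiv ℝ u z b) ((fderiv ℝ (fderiv ℝ u) y).flip b) y := by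
  simpa using (hasFDerivAt_fderiv hu).clm_apply (hasFDerivAt_const b y)

lemma fderiv_fderiv_comm (hu : ContDiffAt ℝ 2 u y) (a b : E) :
    fderiv ℝ (fderiv ℝ u) y a b = fderiv ℝ (fderiv ℝ u) y b a :=
  (hu.isSymmSndFDerivAt (by simp)).eq a b

end

variable {V : Type*} [NormedAddCommGroup V] [InnerProductSpace ℝ V] {y : E}

lemma fderiv_inner_fderiv {u v : E → V} (hu : ContDiffAt ℝ 2 u y) (hv : ContDiffAt ℝ 2 v y)
    (a b c : E) :
    fderiv ℝ (fun z => ⟪fderiv ℝ u z b, fderiv ℝ v z c⟫_ℝ) y a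
      = ⟪fderiv ℝ (fderiv ℝ u) y a b, fderiv ℝ v y c⟫_ℝ
        + ⟪fderiv ℝ u y b, fderiv ℝ (fderiv ℝ v) y a c⟫_ℝ := by
  have hub := hasFDerivAt_fderiv_apply hu b
  have hvc := hasFDerivAt_fderiv_apply hv c
  rw [fderiv_inner_apply ℝ hub.differentiableAt hvc.differentiableAt, hub.fderiv, hvc.fderiv,
    add_comm]
  rfl

lemma koszul {F : E → V} (hF : ContDiffAt ℝ 2 F y) {G : E → E → E → ℝ}
    (hG : ∀ᶠ z in nhds y, ∀ a b, G z a b = ⟪fderiv ℝ F z a, fderiv ℝ F z b⟫_ℝ) (a b c : E) :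
    fderiv ℝ (fun z => G z b c) y a + fderiv ℝ (fun z => G z a c) y b
      - fderiv ℝ (fun z => G z a b) y c = 2 * ⟪fderiv ℝ (fderiv ℝ F) y a b, fderiv ℝ F y c⟫_ℝ := by
  have hderiv : ∀ a b c, fderiv ℝ (fun z => G z b c) y a
      = ⟪fderiv ℝ (fderiv ℝ F) y a b, fderiv ℝ F y c⟫_ℝ
        + ⟪fderiv ℝ (fderiv ℝ F) y a c, fderiv ℝ F y b⟫_ℝ := fun a b c => by
    have hGbc : (fun z => G z b c) =ᶠ[nhds y] fun z => ⟪fderiv ℝ F z b, fderiv ℝ F z c⟫_ℝ :=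
      hG.mono fun z hz => hz b c
    rw [hGbc.fderiv_eq, fderiv_inner_fderiv hF hF, real_inner_comm (fderiv ℝ F y b)]
  rw [hderiv, hderiv, hderiv, fderiv_fderiv_comm hF b a, fderiv_fderiv_comm hF c a,
    fderiv_fderiv_comm hF c b]
  ring

lemma inner_fderiv_fderiv_add_eq_zero {T F : E → V} (hT : ContDiffAt ℝ 2 T y)
    (hF : ContDiffAt ℝ 2 F y)
    (h : ∀ᶠ z in nhds y, ∀ a b : E,
      ⟪fderiv ℝ T z a, fderiv ℝ F z b⟫_ℝ + ⟪fderiv ℝ F z a, fderiv ℝ T z b⟫_ℝ = 0) (a b c : E) :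
    ⟪fderiv ℝ (fderiv ℝ T) y a b, fderiv ℝ F y c⟫_ℝ
      + ⟪fderiv ℝ (fderiv ℝ F) y a b, fderiv ℝ T y c⟫_ℝ = 0 := by
  have hderiv : ∀ a b c,
      ⟪fderiv ℝ (fderiv ℝ T) y a b, fderiv ℝ F y c⟫_ℝ
        + ⟪fderiv ℝ (fderiv ℝ F) y a c, fderiv ℝ T y b⟫_ℝ
        + ⟪fderiv ℝ (fderiv ℝ T) y a c, fderiv ℝ F y b⟫_ℝ
        + ⟪fderiv ℝ (fderiv ℝ F) y a b, fderiv ℝ T y c⟫_ℝ = 0 := fun a b c => by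
    have hTF : (fun z => ⟪fderiv ℝ T z b, fderiv ℝ F z c⟫_ℝ)
        =ᶠ[nhds y] fun z => -⟪fderiv ℝ F z b, fderiv ℝ T z c⟫_ℝ :=
      h.mono fun z hz => eq_neg_of_add_eq_zero_left (hz b c)
    have hd := congrArg (fun L : E →L[ℝ] ℝ => L a) (hTF.fderiv_eq (𝕜 := ℝ))
    simp only [fderiv_fun_neg, neg_apply, fderiv_inner_fderiv hT hF,
      fderiv_inner_fderiv hF hT] at hd
    rw [real_inner_comm _ (fderiv ℝ T y b), real_inner_comm _ (fderiv ℝ F y b)] at hd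
    linarith
  have hab := hderiv a b c
  have hba := hderiv b a c
  have hca := hderiv c a b
  rw [fderiv_fderiv_comm hT b a, fderiv_fderiv_comm hF b a] at hba
  rw [fderiv_fderiv_comm hT c a, fderiv_fderiv_comm hF c a, fderiv_fderiv_comm hT c b,
    fderiv_fderiv_comm hF c b] at hca
  linarith

lemma inner_fderiv_eq_zero {F : E → V} {w : V} {c : ℝ} (hF : DifferentiableAt ℝ F y)
    (h : ∀ᶠ z in nhds y, ⟪w, F z⟫_ℝ = c) (a : E) : ⟪w, fderiv ℝ F y a⟫_ℝ = 0 := by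
  have hconst : (fun z => ⟪w, F z⟫_ℝ) =ᶠ[nhds y] fun _ => c := h
  have := congrArg (fun L : E →L[ℝ] ℝ => L a) hconst.fderiv_eq
  simpa [fderiv_inner_apply ℝ (differentiableAt_const w) hF] using this

lemma inner_fderiv_fderiv_eq_zero {F : E → V} {w : V} {c : ℝ} (hF : ContDiffAt ℝ 2 F y)
    (h : ∀ᶠ z in nhds y, ⟪w, F z⟫_ℝ = c) (a b : E) : ⟪w, fderiv ℝ (fderiv ℝ F) y a b⟫_ℝ = 0 := by
  have hb := hasFDerivAt_fderiv_apply hF b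
  have hfirst : ∀ᶠ z in nhds y, ⟪w, fderiv ℝ F z b⟫_ℝ = 0 := by
    filter_upwards [h.eventually_nhds, hF.eventually (by simp)] with z hz hFz
    exact inner_fderiv_eq_zero (hFz.differentiableAt (by norm_num)) hz b
  simpa [hb.fderiv] using inner_fderiv_eq_zero hb.differentiableAt hfirst a

end Flat

section Chart

variable {E : Type*} [NormedAddCommGroup E] [NormedSpace ℝ E]
  {H : Type*} [TopologicalSpace H] {I : ModelWithCorners ℝ E H}
  {M : Type*} [TopologicalSpace M] [ChartedSpace H M]
  {V : Type*} [NormedAddCommGroup V] [InnerProductSpace ℝ V]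

lemma diff_clm_comp {V' : Type*} [NormedAddCommGroup V'] [InnerProductSpace ℝ V'] (L : V →L[ℝ] V')
    {u : M → V} {x : M} (hu : MDifferentiableAt I 𝓘(ℝ, V) u x) (a : E) :
    diff I (L ∘ u) x a = L (diff I u x a) := by
  unfold diff
  rw [(L.hasMFDerivAt.comp x hu.hasMFDerivAt).mfderiv]
  rfl

variable [I.Boundaryless]

lemma diff_eq_fderiv {u : M → V} {x : M} (hu : MDifferentiableAt I 𝓘(ℝ, V) u x) :
    diff I u x = fderiv ℝ (u ∘ (extChartAt I x).symm) (extChartAt I x x) := by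
  unfold diff
  rw [hu.mfderiv, I.range_eq_univ, fderivWithin_univ]
  rfl

lemma hasFDerivAt_comp_extChartAt_symm [IsManifold I 1 M] {u : M → V} (x : M) {y : E}
    (hy : y ∈ (extChartAt I x).target) {u' : E →L[ℝ] V}
    (hu : HasMFDerivAt I 𝓘(ℝ, V) u ((extChartAt I x).symm y) u') :
    HasFDerivAt (u ∘ (extChartAt I x).symm)
      (u'.comp (mfderiv 𝓘(ℝ, E) I (extChartAt I x).symm y : E →L[ℝ] E)) y := by
  have hsymm : MDifferentiableAt 𝓘(ℝ, E) I (extChartAt I x).symm y :=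
    (mdifferentiableOn_extChartAt_symm).mdifferentiableAt ((isOpen_extChartAt_target x).mem_nhds hy)
  exact (hu.comp y hsymm.hasMFDerivAt).hasFDerivAt

lemma eventually_eq_of_hasMFDerivAt_zero [IsManifold I 1 M] {u : M → V} {x : M}
    (hu : ∀ᶠ p in nhds x, HasMFDerivAt I 𝓘(ℝ, V) u p 0) : ∀ᶠ p in nhds x, u p = u x := by
  obtain ⟨ε, hε, hball⟩ := Metric.mem_nhds_iff.1 (Filter.inter_mem
    (extChartAt_preimage_mem_nhds (I := I) hu) (extChartAt_target_mem_nhds (I := I) x))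
  have hderiv : ∀ y ∈ Metric.ball (extChartAt I x x) ε,
      HasFDerivAt (u ∘ (extChartAt I x).symm) 0 y := fun y hy =>
    (hasFDerivAt_comp_extChartAt_symm x (hball hy).2 (hball hy).1).congr_fderiv
      (ContinuousLinearMap.zero_comp _)
  filter_upwards [extChartAt_source_mem_nhds (I := I) x,
    (continuousAt_extChartAt (I := I) x) (Metric.ball_mem_nhds _ hε)] with p hp hpε
  have hconst := Metric.isOpen_ball.is_const_of_fderiv_eq_zero (𝕜 := ℝ)
    (convex_ball _ ε).isPreconnected
    (fun y hy => (hderiv y hy).differentiableAt.differentiableWithinAt)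
    (fun y hy => (hderiv y hy).fderiv) hpε (Metric.mem_ball_self hε)
  simpa only [Function.comp_apply, (extChartAt I x).left_inv hp, extChartAt_to_inv] using hconst

lemma eq_of_hasMFDerivAt_zero [IsManifold I 1 M] {u : M → V} {U : Set M} (hU : IsOpen U)
    (hc : IsPreconnected U) (hu : ∀ p ∈ U, HasMFDerivAt I 𝓘(ℝ, V) u p 0) {p q : M}
    (hp : p ∈ U) (hq : q ∈ U) : u p = u q :=
  hc.induction₂ (fun p q => u p = u q)
    (fun _ hp => nhdsWithin_le_nhds ((eventually_eq_of_hasMFDerivAt_zero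
      (Filter.eventually_of_mem (hU.mem_nhds hp) hu)).mono fun _ h => h.symm))
    (fun _ _ _ _ _ _ => Eq.trans) (fun _ _ _ _ => Eq.symm) hp hq

lemma contDiffAt_comp_extChartAt_symm {k : ℕ∞ω} [IsManifold I k M] {u : M → V}
    (hu : ContMDiff I 𝓘(ℝ, V) k u) (x : M) {y : E} (hy : y ∈ (extChartAt I x).target) :
    ContDiffAt ℝ k (u ∘ (extChartAt I x).symm) y :=
  (hu.comp_contMDiffOn (contMDiffOn_extChartAt_symm x)).contDiffOn.contDiffAt
    ((isOpen_extChartAt_target x).mem_nhds hy)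

end Chart

lemma IsInfinitesimalBendingOn.mono {E : Type*} [NormedAddCommGroup E] [NormedSpace ℝ E]
    {H : Type*} [TopologicalSpace H] {I : ModelWithCorners ℝ E H}
    {M : Type*} [TopologicalSpace M] [ChartedSpace H M]
    {V : Type*} [NormedAddCommGroup V] [InnerProductSpace ℝ V] {f T : M → V} {U U' : Set M}
    (h : IsInfinitesimalBendingOn I f T U) (hU' : IsOpen U') (hsub : U' ⊆ U) :
    IsInfinitesimalBendingOn I f T U' :=
  ⟨hU', h.smooth.mono hsub, fun x hx => h.bending x (hsub hx)⟩

section Immersion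

variable {E : Type*} [NormedAddCommGroup E] [NormedSpace ℝ E]
  {H : Type*} [TopologicalSpace H] {I : ModelWithCorners ℝ E H} [I.Boundaryless]
  {M : Type*} [TopologicalSpace M] [ChartedSpace H M] [IsManifold I ∞ M]
  {V : Type*} [NormedAddCommGroup V] [InnerProductSpace ℝ V]
  {g : ∀ x : M, TangentSpace I x → TangentSpace I x → ℝ} {f T : M → V}

lemma contDiffAt_two_comp_extChartAt_symm {u : M → V} (hu : ContMDiff I 𝓘(ℝ, V) ∞ u) (x : M) :
    ContDiffAt ℝ 2 (u ∘ (extChartAt I x).symm) (extChartAt I x x) :=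
  (contDiffAt_comp_extChartAt_symm hu x (mem_extChartAt_target x)).of_le (by norm_cast)

lemma fderiv_comp_extChartAt_symm {u : M → V} (hu : ContMDiff I 𝓘(ℝ, V) ∞ u) (x : M) {y : E}
    (hy : y ∈ (extChartAt I x).target) (a : E) :
    fderiv ℝ (u ∘ (extChartAt I x).symm) y a
      = diff I u ((extChartAt I x).symm y) (mfderiv 𝓘(ℝ, E) I (extChartAt I x).symm y a) := by
  rw [← mfderiv_eq_fderiv, mfderiv_comp y (hu.mdifferentiableAt (by simp))
    (mdifferentiableOn_extChartAt_symm.mdifferentiableAt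
      ((isOpen_extChartAt_target x).mem_nhds hy))]
  rfl

lemma eventually_chartMetric_eq (hf : IsIsometricImmersion I g f) (x : M) :
    ∀ᶠ y in nhds (extChartAt I x x), ∀ a b, chartMetric I g x y a b
      = ⟪fderiv ℝ (f ∘ (extChartAt I x).symm) y a, fderiv ℝ (f ∘ (extChartAt I x).symm) y b⟫_ℝ := by
  filter_upwards [extChartAt_target_mem_nhds (I := I) x] with y hy a b
  simp only [fderiv_comp_extChartAt_symm hf.smooth x hy]
  exact (hf.isometric _ _ _).symm

lemma eventually_inner_fderiv_add_eq_zero (hf : ContMDiff I 𝓘(ℝ, V) ∞ f)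
    (hT : IsInfinitesimalBendingOn I f T univ) (x : M) :
    ∀ᶠ y in nhds (extChartAt I x x), ∀ a b,
      ⟪fderiv ℝ (T ∘ (extChartAt I x).symm) y a, fderiv ℝ (f ∘ (extChartAt I x).symm) y b⟫_ℝ
        + ⟪fderiv ℝ (f ∘ (extChartAt I x).symm) y a, fderiv ℝ (T ∘ (extChartAt I x).symm) y b⟫_ℝ
          = 0 := by
  filter_upwards [extChartAt_target_mem_nhds (I := I) x] with y hy a b
  simp only [fderiv_comp_extChartAt_symm hf x hy,
    fderiv_comp_extChartAt_symm (contMDiffOn_univ.1 hT.smooth) x hy]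
  exact hT.bending _ trivial _ _

variable [FiniteDimensional ℝ V]

lemma diff_christoffel (hf : IsIsometricImmersion I g f) (x : M) (a b : E) :
    diff I f x (christoffel I g x a b) = (diff I f x).range.starProjection
      (fderiv ℝ (fderiv ℝ (f ∘ (extChartAt I x).symm)) (extChartAt I x x) a b) := by
  set F := f ∘ (extChartAt I x).symm
  set y := extChartAt I x x
  set K := (diff I f x).range
  have hdiff : diff I f x = fderiv ℝ F y := diff_eq_fderiv (hf.smooth.mdifferentiable (by simp) x)
  have hmetric := eventually_chartMetric_eq hf x
  have hmetric_self : ∀ w c, chartMetric I g x y w c = ⟪diff I f x w, diff I f x c⟫_ℝ := by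
    rw [hdiff]
    exact hmetric.self_of_nhds
  have hkoszul : ∀ c, (chartMetricDeriv I g x a b c + chartMetricDeriv I g x b a c
      - chartMetricDeriv I g x c a b) / 2 = ⟪fderiv ℝ (fderiv ℝ F) y a b, diff I f x c⟫_ℝ := by
    intro c
    rw [hdiff, div_eq_iff two_ne_zero, mul_comm]
    exact koszul (contDiffAt_two_comp_extChartAt_symm hf.smooth x) hmetric a b c
  obtain ⟨w, hw⟩ : K.starProjection (fderiv ℝ (fderiv ℝ F) y a b) ∈ K :=
    Submodule.starProjection_apply_mem _ _
  have hexists : ∃ w : E, ∀ c : E, chartMetric I g x y w c = (chartMetricDeriv I g x a b c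
      + chartMetricDeriv I g x b a c - chartMetricDeriv I g x c a b) / 2 := by
    refine ⟨w, fun c => ?_⟩
    have horth := Submodule.starProjection_inner_eq_zero (K := K)
      (fderiv ℝ (fderiv ℝ F) y a b) (diff I f x c) (LinearMap.mem_range_self _ c)
    rw [inner_sub_left, sub_eq_zero] at horth
    exact (hmetric_self w c).trans
      ((congrArg (inner ℝ · _) hw).trans (horth.symm.trans (hkoszul c).symm))
  refine (Submodule.eq_starProjection_of_mem_of_inner_eq_zero
    (LinearMap.mem_range_self _ _) ?_).symm
  rintro _ ⟨c, rfl⟩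
  rw [inner_sub_left, sub_eq_zero]
  exact (hkoszul c).symm.trans ((Classical.epsilon_spec hexists c).symm.trans (hmetric_self _ c))

lemma fderiv_fderiv_eq_zero_of_bendingTensor_eq_zero (hf : IsIsometricImmersion I g f) {x : M}
    (hinj : Function.Injective (diff I f x)) (hT : IsInfinitesimalBendingOn I f T univ) {a b : E}
    (hfab : fderiv ℝ (fderiv ℝ (f ∘ (extChartAt I x).symm)) (extChartAt I x x) a b = 0)
    (hab : bendingTensor I g f T x a b = 0) :
    fderiv ℝ (fderiv ℝ (T ∘ (extChartAt I x).symm)) (extChartAt I x x) a b = 0 := by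
  have hT' := contMDiffOn_univ.1 hT.smooth
  have hΓ : christoffel I g x a b = 0 := by
    refine hinj ?_
    rw [diff_christoffel hf, hfab, map_zero, map_zero]
  have hhess : hessian I g T x a b
      = fderiv ℝ (fderiv ℝ (T ∘ (extChartAt I x).symm)) (extChartAt I x x) a b := by
    unfold hessian
    rw [hΓ, map_zero, sub_zero]
  unfold bendingTensor at hab
  rw [hhess, Submodule.starProjection_apply_eq_zero_iff, normalSpace,
    Submodule.orthogonal_orthogonal] at hab
  obtain ⟨c, hc⟩ := hab
  have hinner := inner_fderiv_fderiv_add_eq_zero (contDiffAt_two_comp_extChartAt_symm hT' x)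
    (contDiffAt_two_comp_extChartAt_symm hf.smooth x)
    (eventually_inner_fderiv_add_eq_zero hf.smooth hT x) a b c
  rwa [hfab, inner_zero_left, add_zero, ← diff_eq_fderiv (hf.smooth.mdifferentiable (by simp) x),
    show diff I f x c = _ from hc, inner_self_eq_zero] at hinner

lemma eq_zero_of_eventually_inner_eq (hf : ContMDiff I 𝓘(ℝ, V) ∞ f) {x : M}
    (hfull : HasFullFirstNormalSpace I g f x) {w : V} {c : ℝ}
    (hw : ∀ᶠ p in nhds x, ⟪w, f p⟫_ℝ = c) : w = 0 := by
  have hF := contDiffAt_two_comp_extChartAt_symm hf x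
  have hw' : ∀ᶠ y in nhds (extChartAt I x x), ⟪w, (f ∘ (extChartAt I x).symm) y⟫_ℝ = c :=
    extChartAt_preimage_mem_nhds hw
  have htangent : ∀ a, ⟪w, diff I f x a⟫_ℝ = 0 := by
    rw [diff_eq_fderiv (hf.mdifferentiable (by simp) x)]
    exact inner_fderiv_eq_zero (hF.differentiableAt (by norm_num)) hw'
  have hhess : ∀ a b, ⟪w, hessian I g f x a b⟫_ℝ = 0 := fun a b => by
    unfold hessian
    rw [inner_sub_right, htangent, sub_zero]
    exact inner_fderiv_fderiv_eq_zero hF hw' a b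
  have hnormal : w ∈ normalSpace I f x := by
    refine (Submodule.mem_orthogonal' _ _).2 ?_
    rintro _ ⟨a, rfl⟩
    exact htangent a
  have hle : normalSpace I f x ≤ (innerSL ℝ w).ker := by
    rw [← hfull, Submodule.span_le]
    rintro _ ⟨a, b, rfl⟩
    change ⟪w, (normalSpace I f x).starProjection (hessian I g f x a b)⟫_ℝ = 0
    rw [← Submodule.inner_starProjection_left_eq_right,
      Submodule.starProjection_eq_self_iff.2 hnormal, hhess]
  exact inner_self_eq_zero.1 (hle hnormal)

lemma affineSpan_image_eq_top (hf : ContMDiff I 𝓘(ℝ, V) ∞ f) {x : M}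
    (hfull : HasFullFirstNormalSpace I g f x) {U : Set M} (hU : U ∈ nhds x) :
    affineSpan ℝ (f '' U) = ⊤ := by
  have hx : f x ∈ f '' U := mem_image_of_mem f (mem_of_mem_nhds hU)
  rw [AffineSubspace.affineSpan_eq_top_iff_vectorSpan_eq_top_of_nonempty _ _ _ ⟨_, hx⟩,
    ← Submodule.orthogonal_eq_bot_iff, Submodule.eq_bot_iff]
  intro w hw
  refine eq_zero_of_eventually_inner_eq (c := ⟪w, f x⟫_ℝ) hf hfull ?_
  filter_upwards [hU] with p hp
  rw [← sub_eq_zero, ← inner_sub_right]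
  exact Submodule.inner_left_of_mem_orthogonal
    (vsub_mem_vectorSpan ℝ (mem_image_of_mem f hp) hx) hw

end Immersion

lemma hasMFDerivAt_comp_extChartAt_zero {E : Type*} [NormedAddCommGroup E] [NormedSpace ℝ E]
    {H : Type*} [TopologicalSpace H] {I : ModelWithCorners ℝ E H}
    {M : Type*} [TopologicalSpace M] [ChartedSpace H M] [IsManifold I 1 M]
    {V : Type*} [NormedAddCommGroup V] [NormedSpace ℝ V] {φ : E → V} {x : M}
    (hφ : HasFDerivAt (𝕜 := ℝ) φ 0 (extChartAt I x x)) :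
    HasMFDerivAt I 𝓘(ℝ, V) (φ ∘ extChartAt I x) x 0 :=
  (hφ.hasMFDerivAt.comp x (hasMFDerivAt_extChartAt (mem_chart_source _ x))).congr_mfderiv
    (ContinuousLinearMap.zero_comp _)

lemma hasFDerivAt_update_left {ι : Type*} [Finite ι] [DecidableEq ι] {E : ι → Type*}
    [∀ i, NormedAddCommGroup (E i)] [∀ i, NormedSpace ℝ (E i)] (i : ι) (e : E i) (y : ∀ k, E k) :
    HasFDerivAt (fun z : ∀ k, E k => Function.update z i e)
      (ContinuousLinearMap.pi (Function.update (fun k => ContinuousLinearMap.proj k) i 0) :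
        (∀ k, E k) →L[ℝ] ∀ k, E k) y := by
  cases nonempty_fintype ι
  refine hasFDerivAt_pi.2 fun k => ?_
  rcases eq_or_ne k i with rfl | hk
  · simpa using hasFDerivAt_const e y
  · simpa [hk] using hasFDerivAt_apply (𝕜 := ℝ) k y

section Separation

variable {ι : Type*} [Fintype ι] [DecidableEq ι] {E H : ι → Type*}
  [∀ i, NormedAddCommGroup (E i)] [∀ i, NormedSpace ℝ (E i)] [∀ i, TopologicalSpace (H i)]
  (I : ∀ i, ModelWithCorners ℝ (E i) (H i)) {M : ι → Type*}
  [∀ i, TopologicalSpace (M i)] [∀ i, ChartedSpace (H i) (M i)]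
  {V : Type*} [NormedAddCommGroup V] [InnerProductSpace ℝ V]

/-- The second derivatives `∂_a ∂_b u` of a map `u` on a product manifold vanish for `a` and `b`
tangent to different factors; such a `u` is locally a sum of functions of the factors. They are
taken in the product chart centred at the point, which is no restriction: changes of product charts
preserve the condition. -/
def HasVanishingMixedDerivs (u : (∀ i, M i) → V) : Prop :=
  ∀ (x : ∀ i, M i) (i j : ι), i ≠ j → ∀ (a : E i) (b : E j),
    fderiv ℝ (fderiv ℝ (u ∘ (extChartAt (ModelWithCorners.pi I) x).symm))
      (extChartAt (ModelWithCorners.pi I) x x) (Pi.single i a) (Pi.single j b) = 0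

variable {I} {u : (∀ i, M i) → V}

lemma HasVanishingMixedDerivs.fderiv_fderiv_eq_zero (h : HasVanishingMixedDerivs I u)
    (x : ∀ i, M i) {i : ι} {c : ∀ k, E k} (hc : c i = 0) (a : E i) :
    fderiv ℝ (fderiv ℝ (u ∘ (extChartAt (ModelWithCorners.pi I) x).symm))
      (extChartAt (ModelWithCorners.pi I) x x) c (Pi.single i a) = 0 := by
  rw [← Finset.univ_sum_single c, map_sum, sum_apply]
  refine Finset.sum_eq_zero fun k _ => ?_
  rcases eq_or_ne k i with rfl | hk
  · rw [hc, Pi.single_zero, map_zero, zero_apply]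
  · exact h x k i hk _ a

variable [∀ i, (I i).Boundaryless]

lemma diff_comp_update {x : ∀ i, M i} {i : ι} {p : M i}
    (hu : MDifferentiableAt (ModelWithCorners.pi I) 𝓘(ℝ, V) u (Function.update x i p)) (a : E i) :
    diff (I i) (u ∘ Function.update x i) p a
      = diff (ModelWithCorners.pi I) u (Function.update x i p) (Pi.single i a) := by
  unfold diff
  rw [(hu.hasMFDerivAt.comp p (hasMFDerivAt_update x i p)).mfderiv]
  rfl

lemma hasFDerivAt_fderiv_update_zero {v : (∀ k, E k) → V} {i : ι} {e a : E i} {y : ∀ k, E k}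
    (hv : ContDiffAt ℝ 2 v (Function.update y i e))
    (hmixed : ∀ c : ∀ k, E k, c i = 0 →
      fderiv ℝ (fderiv ℝ v) (Function.update y i e) c (Pi.single i a) = 0) :
    HasFDerivAt (𝕜 := ℝ)
      (fun z : ∀ k, E k => fderiv ℝ v (Function.update z i e) (Pi.single i a)) 0 y := by
  refine ((hasFDerivAt_fderiv_apply hv _).comp y (hasFDerivAt_update_left i e y)).congr_fderiv ?_
  ext1 c
  exact hmixed _ (by simp)

variable [∀ i, IsManifold (I i) ∞ (M i)]

lemma diff_comp_update_eq_fderiv (hu : ContMDiff (ModelWithCorners.pi I) 𝓘(ℝ, V) ∞ u)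
    {x x' : ∀ i, M i} (hx' : x' ∈ (extChartAt (ModelWithCorners.pi I) x).source) (i : ι) (p : M i)
    (a : E i) :
    diff (I i) (u ∘ Function.update x' i) p a
      = fderiv ℝ (u ∘ (extChartAt (ModelWithCorners.pi I) (Function.update x i p)).symm)
        (Function.update (extChartAt (ModelWithCorners.pi I) x x') i (extChartAt (I i) p p))
        (Pi.single i a) := by
  set y := Function.update (extChartAt (ModelWithCorners.pi I) x x') i (extChartAt (I i) p p)
  have hslice : MDifferentiableAt (I i) 𝓘(ℝ, V) (u ∘ Function.update x' i) p :=
    (hu.comp (contMDiff_update x' i)).mdifferentiable (by simp) p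
  have hx'i : ∀ k, x' k ∈ (extChartAt (I k) (x k)).source := fun k => by
    rw [extChartAt_source] at hx' ⊢
    exact hx' k trivial
  have hchart : (u ∘ Function.update x' i) ∘ (extChartAt (I i) p).symm
      = (u ∘ (extChartAt (ModelWithCorners.pi I) (Function.update x i p)).symm)
        ∘ Function.update (extChartAt (ModelWithCorners.pi I) x x') i := by
    ext1 z
    refine congrArg u (funext fun k => ?_)
    rw [extChartAt_pi_symm_apply]
    rcases eq_or_ne k i with rfl | hk
    · simp only [Function.update_self]
    · simp only [Function.update_of_ne hk, extChartAt_pi_apply, (extChartAt _ _).left_inv (hx'i k)]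
  have hy : y ∈ (extChartAt (ModelWithCorners.pi I) (Function.update x i p)).target := by
    rw [extChartAt_pi_target]
    intro k _
    rcases eq_or_ne k i with rfl | hk
    · simp only [y, Function.update_self, mem_extChartAt_target]
    · simp only [y, Function.update_of_ne hk, extChartAt_pi_apply]
      exact (extChartAt _ _).map_source (hx'i k)
  have huy := (contDiffAt_comp_extChartAt_symm hu _ hy).differentiableAt (by simp)
  rw [diff_eq_fderiv hslice, hchart, (huy.hasFDerivAt.comp _ (hasFDerivAt_update _ _)).fderiv]
  refine congrArg _ (funext fun k => ?_)
  rcases eq_or_ne k i with rfl | hk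
  · simp
  · simp [hk]

lemma HasVanishingMixedDerivs.hasMFDerivAt_zero (h : HasVanishingMixedDerivs I u)
    (hu : ContMDiff (ModelWithCorners.pi I) 𝓘(ℝ, V) ∞ u) (i : ι) (p : M i) (a : E i)
    (x : ∀ i, M i) :
    HasMFDerivAt (ModelWithCorners.pi I) 𝓘(ℝ, V)
      (fun x' => diff (I i) (u ∘ Function.update x' i) p a) x 0 := by
  set q := Function.update x i p
  set y := extChartAt (ModelWithCorners.pi I) x x
  have hq :
      Function.update y i (extChartAt (I i) p p) = extChartAt (ModelWithCorners.pi I) q q := by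
    ext1 k
    rcases eq_or_ne k i with rfl | hk
    · simp only [extChartAt_pi_apply, q, Function.update_self]
    · simp only [extChartAt_pi_apply, q, y, Function.update_of_ne hk]
  have hφ := hasFDerivAt_fderiv_update_zero (y := y) (e := extChartAt (I i) p p) (a := a)
    (v := u ∘ (extChartAt (ModelWithCorners.pi I) q).symm)
    (by rw [hq]; exact contDiffAt_two_comp_extChartAt_symm hu q)
    (by rw [hq]; exact fun c hc => h.fderiv_fderiv_eq_zero q hc a)
  refine (hasMFDerivAt_comp_extChartAt_zero hφ).congr_of_eventuallyEq ?_
  filter_upwards [extChartAt_source_mem_nhds (I := ModelWithCorners.pi I) x] with x' hx'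
  exact diff_comp_update_eq_fderiv hu hx' i p a

variable {U : ∀ i, Set (M i)} (hU : ∀ i, IsOpen (U i)) (hU' : ∀ i, IsPreconnected (U i))

include hU hU'

lemma HasVanishingMixedDerivs.diff_comp_update_eq (h : HasVanishingMixedDerivs I u)
    (hu : ContMDiff (ModelWithCorners.pi I) 𝓘(ℝ, V) ∞ u) {x x' : ∀ i, M i} (hx : x ∈ univ.pi U)
    (hx' : x' ∈ univ.pi U) (i : ι) (p : M i) :
    diff (I i) (u ∘ Function.update x i) p = diff (I i) (u ∘ Function.update x' i) p := by
  ext1 a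
  exact eq_of_hasMFDerivAt_zero (isOpen_set_pi finite_univ fun k _ => hU k)
    (isPreconnected_univ_pi hU') (fun z _ => h.hasMFDerivAt_zero hu i p a z) hx hx'

lemma HasVanishingMixedDerivs.update_sub_update (h : HasVanishingMixedDerivs I u)
    (hu : ContMDiff (ModelWithCorners.pi I) 𝓘(ℝ, V) ∞ u) {x x' : ∀ i, M i} (hx : x ∈ univ.pi U)
    (hx' : x' ∈ univ.pi U) {i : ι} {p q : M i} (hp : p ∈ U i) (hq : q ∈ U i) :
    u (Function.update x i p) - u (Function.update x i q)
      = u (Function.update x' i p) - u (Function.update x' i q) := by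
  have hslice : ∀ y : ∀ k, M k, MDifferentiable (I i) 𝓘(ℝ, V) (u ∘ Function.update y i) := fun y =>
    (hu.comp (contMDiff_update y i)).mdifferentiable (by simp)
  have hzero : ∀ p, HasMFDerivAt (I i) 𝓘(ℝ, V)
      (u ∘ Function.update x i - u ∘ Function.update x' i) p 0 := fun p =>
    ((hslice x p).hasMFDerivAt.sub (hslice x' p).hasMFDerivAt).congr_mfderiv
      (sub_eq_zero.2 (h.diff_comp_update_eq hU hU' hu hx hx' i p))
  have heq := eq_of_hasMFDerivAt_zero (hU i) (hU' i) (fun p _ => hzero p) hp hq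
  simp only [Pi.sub_apply, Function.comp_apply] at heq
  rw [sub_eq_sub_iff_sub_eq_sub, heq]

lemma HasVanishingMixedDerivs.sub_eq_sum (h : HasVanishingMixedDerivs I u)
    (hu : ContMDiff (ModelWithCorners.pi I) 𝓘(ℝ, V) ∞ u) {x x₀ : ∀ i, M i} (hx : x ∈ univ.pi U)
    (hx₀ : x₀ ∈ univ.pi U) :
    u x - u x₀ = ∑ i, (u (Function.update x₀ i (x i)) - u x₀) := by
  suffices hs : ∀ s : Finset ι,
      u (s.piecewise x x₀) - u x₀ = ∑ i ∈ s, (u (Function.update x₀ i (x i)) - u x₀) by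
    simpa using hs Finset.univ
  intro s
  induction s using Finset.induction_on with
  | empty => simp
  | insert i s hi ih =>
    have hpw : s.piecewise x x₀ ∈ univ.pi U := s.piecewise_mem_set_pi hx hx₀
    have hstep := h.update_sub_update hU hU' hu hpw hx₀ (hx i trivial) (hx₀ i trivial)
    rw [Function.update_eq_self, Function.update_eq_self_iff.2
      (s.piecewise_eq_of_notMem x x₀ hi).symm] at hstep
    rw [Finset.sum_insert hi, Finset.piecewise_insert, ← ih, ← hstep]
    abel

end Separation

section ProductMap

variable {ι : Type*} [Fintype ι] {E W : ι → Type*}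
  [∀ i, NormedAddCommGroup (E i)] [∀ i, NormedSpace ℝ (E i)]
  [∀ i, NormedAddCommGroup (W i)]

section

variable [∀ i, NormedSpace ℝ (W i)]

lemma fderiv_toLp_pi_apply {F : ∀ i, E i → W i} {y : ∀ i, E i}
    (hF : ∀ i, DifferentiableAt ℝ (F i) (y i)) (X : ∀ i, E i) :
    fderiv ℝ (fun z : ∀ i, E i => WithLp.toLp 2 fun i => F i (z i)) y X
      = WithLp.toLp 2 fun i => fderiv ℝ (F i) (y i) (X i) := by
  have hpi : HasFDerivAt (fun (z : ∀ i, E i) i => F i (z i))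
      (ContinuousLinearMap.pi fun i =>
        (fderiv ℝ (F i) (y i)).comp (ContinuousLinearMap.proj i)) y :=
    hasFDerivAt_pi.2 fun i =>
      HasFDerivAt.comp (f := fun z : ∀ i, E i => z i) y (hF i).hasFDerivAt (hasFDerivAt_apply i y)
  exact DFunLike.congr_fun ((PiLp.hasFDerivAt_toLp 2 _).comp y hpi).fderiv X

lemma fderiv_fderiv_toLp_pi_apply {F : ∀ i, E i → W i} {y : ∀ i, E i}
    (hF : ∀ i, ContDiffAt ℝ 2 (F i) (y i)) (X Y : ∀ i, E i) :
    fderiv ℝ (fderiv ℝ fun z : ∀ i, E i => WithLp.toLp 2 fun i => F i (z i)) y X Y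
      = WithLp.toLp 2 fun i => fderiv ℝ (fderiv ℝ (F i)) (y i) (X i) (Y i) := by
  have hF₂ : ContDiffAt ℝ 2 (fun z : ∀ i, E i => WithLp.toLp 2 fun i => F i (z i)) y :=
    (PiLp.contDiff_toLp.contDiffAt (x := fun i => F i (y i))).comp y (contDiffAt_pi.2 fun i =>
      ContDiffAt.comp (f := fun z : ∀ i, E i => z i) y (hF i)
        (contDiff_pi.1 contDiff_id i).contDiffAt)
  have hfirst : ∀ᶠ z in nhds y,
      fderiv ℝ (fun z : ∀ i, E i => WithLp.toLp 2 fun i => F i (z i)) z Y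
        = WithLp.toLp 2 fun i => fderiv ℝ (F i) (z i) (Y i) := by
    filter_upwards [Filter.eventually_all.2 fun i => (continuousAt_apply i y).eventually
      ((hF i).eventually (by simp))] with z hz
    exact fderiv_toLp_pi_apply (fun i => (hz i).differentiableAt (by norm_num)) Y
  have hsecond := fun i => hasFDerivAt_fderiv_apply (hF i) (Y i)
  rw [← ContinuousLinearMap.flip_apply, ← (hasFDerivAt_fderiv_apply hF₂ Y).fderiv,
    Filter.EventuallyEq.fderiv_eq hfirst,
    fderiv_toLp_pi_apply (F := fun i z => fderiv ℝ (F i) z (Y i))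
      fun i => (hsecond i).differentiableAt]
  simp only [(hsecond _).fderiv, ContinuousLinearMap.flip_apply]

end

variable [∀ i, InnerProductSpace ℝ (W i)] {H : ι → Type*} [∀ i, TopologicalSpace (H i)]
  {I : ∀ i, ModelWithCorners ℝ (E i) (H i)} [∀ i, (I i).Boundaryless] {M : ι → Type*}
  [∀ i, TopologicalSpace (M i)] [∀ i, ChartedSpace (H i) (M i)] {f : ∀ i, M i → W i}

lemma contMDiff_toLp_pi {k : ℕ∞ω} (hf : ∀ i, ContMDiff (I i) 𝓘(ℝ, W i) k (f i)) :
    ContMDiff (ModelWithCorners.pi I) 𝓘(ℝ, PiLp 2 W) k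
      fun x : ∀ i, M i => WithLp.toLp 2 fun i => f i (x i) :=
  PiLp.contDiff_toLp.contMDiff.comp
    (contMDiff_pi_space.2 fun i => (hf i).comp (contMDiff_apply i))

variable [∀ i, IsManifold (I i) ∞ (M i)] (hf : ∀ i, ContMDiff (I i) 𝓘(ℝ, W i) ∞ (f i))

include hf

lemma diff_toLp_pi_apply (x : ∀ i, M i) (X : ∀ i, E i) :
    diff (ModelWithCorners.pi I) (fun x : ∀ i, M i => WithLp.toLp 2 fun i => f i (x i)) x X
      = WithLp.toLp 2 fun i => diff (I i) (f i) (x i) (X i) := by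
  rw [diff_eq_fderiv ((contMDiff_toLp_pi hf).mdifferentiable (by simp) x)]
  simp only [diff_eq_fderiv ((hf _).mdifferentiable (by simp) _)]
  exact fderiv_toLp_pi_apply (F := fun i => f i ∘ (extChartAt (I i) (x i)).symm) (fun i =>
    (contDiffAt_two_comp_extChartAt_symm (hf i) (x i)).differentiableAt (by norm_num)) X

lemma diff_toLp_pi_single [DecidableEq ι] (x : ∀ i, M i) (i : ι) (a : E i) :
    diff (ModelWithCorners.pi I) (fun x : ∀ i, M i => WithLp.toLp 2 fun i => f i (x i)) x
      (Pi.single i a) = PiLp.single 2 i (diff (I i) (f i) (x i) a) := by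
  rw [diff_toLp_pi_apply hf]
  ext k
  rcases eq_or_ne k i with rfl | hk
  · simp
  · simp [hk]

lemma hasVanishingMixedDerivs_toLp_pi [DecidableEq ι] :
    HasVanishingMixedDerivs I fun x : ∀ i, M i => WithLp.toLp 2 fun i => f i (x i) := by
  intro x i j hij a b
  refine (fderiv_fderiv_toLp_pi_apply (F := fun i => f i ∘ (extChartAt (I i) (x i)).symm)
    (fun i => contDiffAt_two_comp_extChartAt_symm (hf i) (x i)) _ _).trans ?_
  ext k
  rcases eq_or_ne k i with rfl | hk
  · simp [hij]
  · simp [hk]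

end ProductMap

section Pairing

variable {E : Type*} [NormedAddCommGroup E] [NormedSpace ℝ E] {H : Type*} [TopologicalSpace H]
  {I : ModelWithCorners ℝ E H} [I.Boundaryless]
  {M : Type*} [TopologicalSpace M] [ChartedSpace H M] [IsManifold I 1 M]
  {E' : Type*} [NormedAddCommGroup E'] [NormedSpace ℝ E'] {H' : Type*} [TopologicalSpace H']
  {I' : ModelWithCorners ℝ E' H'} [I'.Boundaryless]
  {M' : Type*} [TopologicalSpace M'] [ChartedSpace H' M'] [IsManifold I' 1 M']
  {V : Type*} [NormedAddCommGroup V] [InnerProductSpace ℝ V]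

lemma inner_sub_add_inner_sub_eq_zero_of_diff {A A' : M → V}
    (hA : MDifferentiable I 𝓘(ℝ, V) A) (hA' : MDifferentiable I 𝓘(ℝ, V) A') {U : Set M}
    (hU : IsOpen U) (hUc : IsPreconnected U) {v v' : V}
    (h : ∀ p ∈ U, ∀ a, ⟪v, diff I A p a⟫_ℝ + ⟪v', diff I A' p a⟫_ℝ = 0) {p q : M} (hp : p ∈ U)
    (hq : q ∈ U) : ⟪v, A p - A q⟫_ℝ + ⟪v', A' p - A' q⟫_ℝ = 0 := by
  have hzero : ∀ p ∈ U, HasMFDerivAt I 𝓘(ℝ, ℝ)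
      (innerSL ℝ v ∘ A + innerSL ℝ v' ∘ A') p 0 := fun p hp =>
    (((innerSL ℝ v).hasMFDerivAt.comp p (hA p).hasMFDerivAt).add
      ((innerSL ℝ v').hasMFDerivAt.comp p (hA' p).hasMFDerivAt)).congr_mfderiv
      (ContinuousLinearMap.ext (h p hp))
  have heq := eq_of_hasMFDerivAt_zero hU hUc hzero hp hq
  simp only [Pi.add_apply, Function.comp_apply, innerSL_apply_apply] at heq
  rw [inner_sub_right, inner_sub_right]
  linarith

lemma inner_sub_sub_add_inner_sub_sub_eq_zero {A A' : M → V} {B B' : M' → V}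
    (hA : MDifferentiable I 𝓘(ℝ, V) A) (hA' : MDifferentiable I 𝓘(ℝ, V) A')
    (hB : MDifferentiable I' 𝓘(ℝ, V) B) (hB' : MDifferentiable I' 𝓘(ℝ, V) B')
    {U : Set M} (hU : IsOpen U) (hUc : IsPreconnected U)
    {U' : Set M'} (hU' : IsOpen U') (hUc' : IsPreconnected U')
    (h : ∀ p ∈ U, ∀ q ∈ U', ∀ a b,
      ⟪diff I A p a, diff I' B q b⟫_ℝ + ⟪diff I A' p a, diff I' B' q b⟫_ℝ = 0)
    {p p₀ : M} (hp : p ∈ U) (hp₀ : p₀ ∈ U) {q q₀ : M'} (hq : q ∈ U') (hq₀ : q₀ ∈ U') :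
    ⟪A p - A p₀, B q - B q₀⟫_ℝ + ⟪A' p - A' p₀, B' q - B' q₀⟫_ℝ = 0 := by
  have hdiff : ∀ p ∈ U, ∀ a,
      ⟪B q - B q₀, diff I A p a⟫_ℝ + ⟪B' q - B' q₀, diff I A' p a⟫_ℝ = 0 := fun p hp a => by
    rw [real_inner_comm, real_inner_comm (diff I A' p a)]
    exact inner_sub_add_inner_sub_eq_zero_of_diff hB hB' hU' hUc' (fun q hq => h p hp q hq a) hq hq₀
  rw [real_inner_comm, real_inner_comm (B' q - B' q₀)]
  exact inner_sub_add_inner_sub_eq_zero_of_diff hA hA' hU hUc hdiff hp hp₀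

end Pairing

lemma exists_skew_linearMap {κ V : Type*} [NormedAddCommGroup V] [InnerProductSpace ℝ V]
    {X σ : κ → V} (hX : Submodule.span ℝ (range X) = ⊤)
    (h : ∀ k l, ⟪σ k, X l⟫_ℝ + ⟪X k, σ l⟫_ℝ = 0) :
    ∃ D : V →ₗ[ℝ] V, (∀ y z, ⟪D y, z⟫_ℝ = -⟪y, D z⟫_ℝ) ∧ ∀ k, D (X k) = σ k := by
  set LX := Finsupp.linearCombination ℝ X
  set Lσ := Finsupp.linearCombination ℝ σ
  have hskew : ∀ c d, ⟪Lσ c, LX d⟫_ℝ + ⟪LX c, Lσ d⟫_ℝ = 0 := by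
    intro c d
    simp only [LX, Lσ, Finsupp.linearCombination_apply, Finsupp.sum, sum_inner, inner_sum,
      real_inner_smul_left, real_inner_smul_right, ← Finset.sum_add_distrib, ← mul_add, h,
      mul_zero, Finset.sum_const_zero]
  have hrange : LX.range = ⊤ := (Finsupp.range_linearCombination ℝ).trans hX
  obtain ⟨R, hR⟩ := LX.exists_rightInverse_of_surjective hrange
  have hLXR : ∀ y, LX (R y) = y := LinearMap.congr_fun hR
  refine ⟨Lσ ∘ₗ R, fun y z => ?_, fun k => ?_⟩
  · simpa only [hLXR, LinearMap.comp_apply] using eq_neg_of_add_eq_zero_left (hskew (R y) (R z))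
  · have hker : LX (R (X k) - Finsupp.single k 1) = 0 := by simp [hLXR, LX]
    have hzero : Lσ (R (X k) - Finsupp.single k 1) = 0 := ext_inner_right ℝ fun z => by
      rw [← hLXR z, inner_zero_left, ← hskew _ (R z), hker, inner_zero_left, add_zero]
    simpa [sub_eq_zero, Lσ] using hzero

section Decomposition

variable {ι : Type*} [DecidableEq ι] {W : ι → Type*} [∀ i, NormedAddCommGroup (W i)]

lemma toLp_pi_update_sub {M : ι → Type*} (f : ∀ i, M i → W i) (x : ∀ i, M i) (i : ι) (p : M i) :
    (WithLp.toLp 2 fun k => f k (Function.update x i p k)) - WithLp.toLp 2 (fun k => f k (x k))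
      = PiLp.single 2 i (f i p - f i (x i)) := by
  ext k
  rcases eq_or_ne k i with rfl | hk
  · simp
  · simp [hk]

variable [Fintype ι]

lemma inner_piLp_single_left [∀ i, InnerProductSpace ℝ (W i)] (i : ι) (w : W i) (y : PiLp 2 W) :
    ⟪PiLp.single 2 i w, y⟫_ℝ = ⟪w, y i⟫_ℝ := by
  rw [PiLp.inner_apply, Finset.sum_eq_single i (fun k _ hk => by simp [hk]) (by simp)]
  simp

lemma inner_sub_single_add_inner_sub_single_eq_zero [∀ i, InnerProductSpace ℝ (W i)]
    {S S' : PiLp 2 W} {i j : ι} {w : W i} {w' : W j}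
    (h : i ≠ j → ⟪S, PiLp.single 2 j w'⟫_ℝ + ⟪PiLp.single 2 i w, S'⟫_ℝ = 0) :
    ⟪S - PiLp.single 2 i (S i), PiLp.single 2 j w'⟫_ℝ
      + ⟪PiLp.single 2 i w, S' - PiLp.single 2 j (S' j)⟫_ℝ = 0 := by
  rcases eq_or_ne i j with rfl | hij
  · simp [real_inner_comm (PiLp.single 2 i w'), inner_piLp_single_left]
  · rw [inner_sub_left, inner_sub_right, inner_piLp_single_left i (S i),
      inner_piLp_single_left i w (PiLp.single 2 j _)]
    simpa [hij] using h hij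

lemma span_range_update_sub_eq_top {M : ι → Type*} {V : Type*} [AddCommGroup V] [Module ℝ V]
    {F : (∀ i, M i) → V} {U : ∀ i, Set (M i)} {x₀ : ∀ i, M i} (hx₀ : x₀ ∈ univ.pi U)
    (hF : ∀ x ∈ univ.pi U, F x - F x₀ = ∑ i, (F (Function.update x₀ i (x i)) - F x₀))
    (hspan : affineSpan ℝ (F '' univ.pi U) = ⊤) :
    Submodule.span ℝ (range fun k : Σ i, U i => F (Function.update x₀ k.1 k.2) - F x₀) = ⊤ := by
  have hx₀F : F x₀ ∈ F '' univ.pi U := mem_image_of_mem F hx₀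
  rw [AffineSubspace.affineSpan_eq_top_iff_vectorSpan_eq_top_of_nonempty ℝ V V ⟨_, hx₀F⟩,
    vectorSpan_eq_span_vsub_set_right ℝ hx₀F] at hspan
  rw [eq_top_iff, ← hspan, Submodule.span_le]
  rintro _ ⟨_, ⟨x, hx, rfl⟩, rfl⟩
  simp only [vsub_eq_sub, hF x hx]
  exact Submodule.sum_mem _ fun i _ => Submodule.subset_span ⟨⟨i, x i, hx i trivial⟩, rfl⟩

variable [∀ i, InnerProductSpace ℝ (W i)] {E H : ι → Type*}
  [∀ i, NormedAddCommGroup (E i)] [∀ i, NormedSpace ℝ (E i)] [∀ i, TopologicalSpace (H i)]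
  {I : ∀ i, ModelWithCorners ℝ (E i) (H i)} [∀ i, (I i).Boundaryless] {M : ι → Type*}
  [∀ i, TopologicalSpace (M i)] [∀ i, ChartedSpace (H i) (M i)] [∀ i, IsManifold (I i) ∞ (M i)]

section

variable {V : Type*} [NormedAddCommGroup V] [InnerProductSpace ℝ V]
  {F T : (∀ i, M i) → V} {U : ∀ i, Set (M i)}

lemma IsInfinitesimalBendingOn.inner_update_sub_add_eq_zero
    (hF : ContMDiff (ModelWithCorners.pi I) 𝓘(ℝ, V) ∞ F) (hFmix : HasVanishingMixedDerivs I F)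
    (hT : IsInfinitesimalBendingOn (ModelWithCorners.pi I) F T univ)
    (hTmix : HasVanishingMixedDerivs I T)
    (hU : ∀ i, IsOpen (U i)) (hU' : ∀ i, IsPreconnected (U i)) {x₀ : ∀ i, M i}
    (hx₀ : x₀ ∈ univ.pi U) {i j : ι} (hij : i ≠ j) {p : M i} (hp : p ∈ U i) {q : M j}
    (hq : q ∈ U j) :
    ⟪T (Function.update x₀ i p) - T x₀, F (Function.update x₀ j q) - F x₀⟫_ℝ
      + ⟪F (Function.update x₀ i p) - F x₀, T (Function.update x₀ j q) - T x₀⟫_ℝ = 0 := by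
  have hTs : ContMDiff (ModelWithCorners.pi I) 𝓘(ℝ, V) ∞ T := contMDiffOn_univ.1 hT.smooth
  have hslice : ∀ {u : (∀ i, M i) → V}, ContMDiff (ModelWithCorners.pi I) 𝓘(ℝ, V) ∞ u →
      ∀ i, MDifferentiable (I i) 𝓘(ℝ, V) (u ∘ Function.update x₀ i) := fun hu i =>
    (hu.comp (contMDiff_update x₀ i)).mdifferentiable (by simp)
  have hmove : ∀ {u : (∀ i, M i) → V}, ContMDiff (ModelWithCorners.pi I) 𝓘(ℝ, V) ∞ u →
      HasVanishingMixedDerivs I u → ∀ (i : ι) (p : M i) {j : ι} {q : M j}, q ∈ U j → ∀ a,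
      diff (I i) (u ∘ Function.update x₀ i) p a = diff (ModelWithCorners.pi I) u
        (Function.update (Function.update x₀ j q) i p) (Pi.single i a) := by
    intro u hu humix i p j q hq a
    rw [humix.diff_comp_update_eq hU hU' hu hx₀ (update_mem_pi_iff_of_mem hx₀ |>.2 fun _ => hq) i p]
    exact diff_comp_update (hu.mdifferentiable (by simp) _) a
  have hmain := inner_sub_sub_add_inner_sub_sub_eq_zero (hslice hTs i) (hslice hF i) (hslice hF j)
    (hslice hTs j) (hU i) (hU' i) (hU j) (hU' j) (fun p hp q hq a b => ?_) hp (hx₀ i trivial) hq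
    (hx₀ j trivial)
  · simpa only [Function.comp_apply, Function.update_eq_self] using hmain
  · rw [hmove hTs hTmix i p hq, hmove hF hFmix i p hq, hmove hTs hTmix j q hp,
      hmove hF hFmix j q hp, Function.update_comm hij]
    exact hT.bending _ trivial _ _

end

variable {f : ∀ i, M i → W i} (hf : ∀ i, ContMDiff (I i) 𝓘(ℝ, W i) ∞ (f i))
  {T : (∀ i, M i) → PiLp 2 W} (hT : IsInfinitesimalBendingOn (ModelWithCorners.pi I)
    (fun x => WithLp.toLp 2 fun i => f i (x i)) T univ)

include hf hT

lemma IsInfinitesimalBendingOn.slice (x : ∀ i, M i) (i : ι) :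
    IsInfinitesimalBendingOn (I i) (f i) (fun p => T (Function.update x i p) i) univ := by
  have hTs := contMDiffOn_univ.1 hT.smooth
  have hslice : ContMDiff (I i) 𝓘(ℝ, PiLp 2 W) ∞ (T ∘ Function.update x i) :=
    hTs.comp (contMDiff_update x i)
  have hdiff : ∀ p a, diff (I i) (fun p => T (Function.update x i p) i) p a
      = diff (ModelWithCorners.pi I) T (Function.update x i p) (Pi.single i a) i := fun p a =>
    (diff_clm_comp (PiLp.proj 2 W i) (hslice.mdifferentiable (by simp) p) a).trans
      (congrArg (· i) (diff_comp_update (hTs.mdifferentiable (by simp) _) a))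
  refine ⟨isOpen_univ,
    ((PiLp.proj 2 W i : PiLp 2 W →L[ℝ] W i).contMDiff.comp hslice).contMDiffOn,
    fun p _ (a b : E i) => ?_⟩
  have hbend := hT.bending (Function.update x i p) trivial (Pi.single i a) (Pi.single i b)
  rw [real_inner_comm, diff_toLp_pi_single hf, diff_toLp_pi_single hf, inner_piLp_single_left,
    inner_piLp_single_left, Function.update_self] at hbend
  rw [hdiff, hdiff, real_inner_comm]
  exact hbend

theorem IsInfinitesimalBendingOn.isTrivialBendingOn_sub_sum_slices
    (hTmix : HasVanishingMixedDerivs I T) {U : ∀ i, Set (M i)} (hU : ∀ i, IsOpen (U i))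
    (hU' : ∀ i, IsPreconnected (U i)) {x₀ : ∀ i, M i} (hx₀ : x₀ ∈ univ.pi U)
    (hspan : affineSpan ℝ ((fun x => WithLp.toLp 2 fun i => f i (x i)) '' univ.pi U) = ⊤) :
    IsTrivialBendingOn (fun x => WithLp.toLp 2 fun i => f i (x i))
      (fun x => T x - ∑ i, PiLp.single 2 i (T (Function.update x₀ i (x i)) i)) (univ.pi U) := by
  set F : (∀ i, M i) → PiLp 2 W := fun x => WithLp.toLp 2 fun i => f i (x i)
  have hF : ContMDiff (ModelWithCorners.pi I) 𝓘(ℝ, PiLp 2 W) ∞ F := contMDiff_toLp_pi hf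
  have hFmix : HasVanishingMixedDerivs I F := hasVanishingMixedDerivs_toLp_pi hf
  have hFsum : ∀ x ∈ univ.pi U, F x - F x₀ = ∑ i, (F (Function.update x₀ i (x i)) - F x₀) :=
    fun x hx => hFmix.sub_eq_sum hU hU' hF hx hx₀
  let S (i : ι) (p : M i) : PiLp 2 W := T (Function.update x₀ i p) - T x₀
  have hskew : ∀ k l : Σ i, U i,
      ⟪S k.1 k.2 - PiLp.single 2 k.1 (S k.1 k.2 k.1), F (Function.update x₀ l.1 l.2) - F x₀⟫_ℝ
        + ⟪F (Function.update x₀ k.1 k.2) - F x₀,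
          S l.1 l.2 - PiLp.single 2 l.1 (S l.1 l.2 l.1)⟫_ℝ = 0 := by
    rintro ⟨i, p, hp⟩ ⟨j, q, hq⟩
    simp only [F, toLp_pi_update_sub]
    refine inner_sub_single_add_inner_sub_single_eq_zero fun hij => ?_
    simpa only [F, toLp_pi_update_sub] using
      hT.inner_update_sub_add_eq_zero hF hFmix hTmix hU hU' hx₀ hij hp hq
  obtain ⟨D, hD, hDS⟩ :=
    exists_skew_linearMap (span_range_update_sub_eq_top hx₀ hFsum hspan) hskew
  refine ⟨D, -D (F x₀), hD, fun x hx => ?_⟩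
  have hself : ∑ i, PiLp.single 2 i (T x₀ i) = T x₀ := by ext k; simp
  calc T x - ∑ i, PiLp.single 2 i (T (Function.update x₀ i (x i)) i)
      = (T x - T x₀) - ∑ i, PiLp.single 2 i (S i (x i) i) := by
        simp only [S, PiLp.sub_apply, PiLp.single_sub, Finset.sum_sub_distrib, hself]
        abel
    _ = ∑ i, (S i (x i) - PiLp.single 2 i (S i (x i) i)) := by
        rw [Finset.sum_sub_distrib, hTmix.sub_eq_sum hU hU' (contMDiffOn_univ.1 hT.smooth) hx hx₀]
    _ = ∑ i, D (F (Function.update x₀ i (x i)) - F x₀) :=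
        Finset.sum_congr rfl fun i _ => (hDS ⟨i, x i, hx i trivial⟩).symm
    _ = D (F x) + -D (F x₀) := by rw [← map_sum, ← hFsum x hx, map_sub, sub_eq_add_neg]

end Decomposition

lemma isOpen_connectedComponent_of_chartedSpace (H : Type*) [TopologicalSpace H]
    [LocallyConnectedSpace H] {M : Type*} [TopologicalSpace M] [ChartedSpace H M] (x : M) :
    IsOpen (connectedComponent x) :=
  have := ChartedSpace.locallyConnectedSpace H M
  isOpen_connectedComponent

section ExtrinsicProduct

variable {r : ℕ} {n m : Fin r → ℕ} {M : Fin r → Type*} [∀ i, TopologicalSpace (M i)]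
  [∀ i, ChartedSpace (EuclideanSpace ℝ (Fin (n i))) (M i)] [∀ i, IsManifold (𝓡 (n i)) ∞ (M i)]
  {g : ∀ i, ContMDiffRiemannianMetric (𝓡 (n i)) ∞ (EuclideanSpace ℝ (Fin (n i)))
    (fun x : M i => TangentSpace (𝓡 (n i)) x)}
  {f : ∀ i, M i → EuclideanSpace ℝ (Fin (m i))}
  (hf : ∀ i, IsIsometricImmersion (𝓡 (n i)) (fun x X Y => (g i).inner x X Y) (f i))

include hf

lemma isIsometricImmersion_extrinsicProduct :
    IsIsometricImmersion (prodModel n) (prodMetric g) (extrinsicProduct f) where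
  smooth := contMDiff_toLp_pi fun i => (hf i).smooth
  isometric x X Y := by
    have hdiff := diff_toLp_pi_apply fun i => (hf i).smooth
    refine (congrArg₂ (inner ℝ) (hdiff x X) (hdiff x Y)).trans ?_
    rw [PiLp.inner_apply]
    exact Finset.sum_congr rfl fun i _ => (hf i).isometric (x i) _ _

lemma injective_diff_extrinsicProduct (x : ∀ i, M i) :
    Function.Injective (diff (prodModel n) (extrinsicProduct f) x) := by
  refine (injective_iff_map_eq_zero _).2 fun X hX => funext fun i => ?_
  have hXi : diff (𝓡 (n i)) (f i) (x i) (X i) = 0 :=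
    congrArg (· i) ((diff_toLp_pi_apply (fun i => (hf i).smooth) x X).symm.trans hX)
  by_contra hne
  refine ((g i).pos (x i) (X i) hne).ne' ?_
  rw [← (hf i).isometric (x i) (X i) (X i)]
  exact inner_self_eq_zero.2 hXi

lemma IsAdapted.hasVanishingMixedDerivs {T : (∀ i, M i) → Ambient m}
    (hβ : IsAdapted (prodMetric g) (extrinsicProduct f) T)
    (hT : IsInfinitesimalBendingOn (prodModel n) (extrinsicProduct f) T univ) :
    HasVanishingMixedDerivs (fun i => 𝓡 (n i)) T := fun x i j hij a b =>
  fderiv_fderiv_eq_zero_of_bendingTensor_eq_zero (isIsometricImmersion_extrinsicProduct hf)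
    (injective_diff_extrinsicProduct hf x) hT
    (hasVanishingMixedDerivs_toLp_pi (fun i => (hf i).smooth) x i j hij a b) (hβ x i j hij a b)

lemma affineSpan_extrinsicProduct_image_connectedComponent {x : ∀ i, M i}
    (hfull : HasFullFirstNormalSpace (prodModel n) (prodMetric g) (extrinsicProduct f) x) :
    affineSpan ℝ (extrinsicProduct f '' univ.pi fun i => connectedComponent (x i)) = ⊤ :=
  affineSpan_image_eq_top (isIsometricImmersion_extrinsicProduct hf).smooth hfull
    ((isOpen_set_pi finite_univ fun i _ => isOpen_connectedComponent_of_chartedSpace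
      (EuclideanSpace ℝ (Fin (n i))) (x i)).mem_nhds fun _ _ => mem_connectedComponent)

end ExtrinsicProduct

end InfBending

end

theorem mainTheorem5_general {r : ℕ} {n m : Fin r → ℕ}
    {M : Fin r → Type*} [∀ i, TopologicalSpace (M i)]
    [∀ i, ChartedSpace (EuclideanSpace ℝ (Fin (n i))) (M i)]
    [∀ i, IsManifold (𝓡 (n i)) ∞ (M i)]
    (g : ∀ i, ContMDiffRiemannianMetric (𝓡 (n i)) ∞ (EuclideanSpace ℝ (Fin (n i)))
      (fun x : M i => TangentSpace (𝓡 (n i)) x))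
    (f : ∀ i, M i → EuclideanSpace ℝ (Fin (m i)))
    (hf : ∀ i, InfBending.IsIsometricImmersion (𝓡 (n i)) (fun x X Y => (g i).inner x X Y) (f i))
    (x₀ : ∀ i, M i)
    (hspan : affineSpan ℝ (InfBending.extrinsicProduct f ''
      Set.univ.pi fun i => connectedComponent (x₀ i)) = ⊤)
    (T : (∀ i, M i) → InfBending.Ambient m)
    (hT : InfBending.IsInfinitesimalBendingOn (InfBending.prodModel n)
      (InfBending.extrinsicProduct f) T Set.univ)
    (hβ : InfBending.IsAdapted (InfBending.prodMetric g) (InfBending.extrinsicProduct f) T) :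
    ∃ T' : ∀ i, M i → EuclideanSpace ℝ (Fin (m i)),
      (∀ i, InfBending.IsInfinitesimalBendingOn (𝓡 (n i)) (f i) (T' i) Set.univ) ∧
      InfBending.IsTrivialBendingOn (InfBending.extrinsicProduct f)
        (fun x => T x - ∑ i, PiLp.single 2 i (T' i (x i)))
        (Set.univ.pi fun i => connectedComponent (x₀ i)) := by
  have hfs := fun i => (hf i).smooth
  exact ⟨fun i p => T (Function.update x₀ i p) i, hT.slice hfs x₀,
    hT.isTrivialBendingOn_sub_sum_slices hfs (hβ.hasVanishingMixedDerivs hf hT)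
      (fun i => InfBending.isOpen_connectedComponent_of_chartedSpace
        (EuclideanSpace ℝ (Fin (n i))) (x₀ i))
      (fun _ => isPreconnected_connectedComponent) (fun _ _ => mem_connectedComponent) hspan⟩

theorem mainTheorem5 {r : ℕ} {n m : Fin r → ℕ} (hn : ∀ i, 2 ≤ n i)
    {M : Fin r → Type*} [∀ i, TopologicalSpace (M i)]
    [∀ i, ChartedSpace (EuclideanSpace ℝ (Fin (n i))) (M i)]
    [∀ i, IsManifold (𝓡 (n i)) ∞ (M i)]
    (g : ∀ i, ContMDiffRiemannianMetric (𝓡 (n i)) ∞ (EuclideanSpace ℝ (Fin (n i)))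
      (fun x : M i => TangentSpace (𝓡 (n i)) x))
    (f : ∀ i, M i → EuclideanSpace ℝ (Fin (m i)))
    (hf : ∀ i, InfBending.IsIsometricImmersion (𝓡 (n i)) (fun x X Y => (g i).inner x X Y) (f i))
    (hfull : ∀ x : ∀ i, M i, InfBending.HasFullFirstNormalSpace (InfBending.prodModel n)
      (InfBending.prodMetric g) (InfBending.extrinsicProduct f) x)
    (T : (∀ i, M i) → InfBending.Ambient m)
    (hT : InfBending.IsInfinitesimalBendingOn (InfBending.prodModel n)
      (InfBending.extrinsicProduct f) T Set.univ)
    (hβ : InfBending.IsAdapted (InfBending.prodMetric g) (InfBending.extrinsicProduct f) T) :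
    ∀ x₀ : ∀ i, M i, ∃ (U : ∀ i, Set (M i)) (T' : ∀ i, M i → EuclideanSpace ℝ (Fin (m i))),
      (∀ i, x₀ i ∈ U i) ∧
      (∀ i, InfBending.IsInfinitesimalBendingOn (𝓡 (n i)) (f i) (T' i) (U i)) ∧
      InfBending.IsTrivialBendingOn (InfBending.extrinsicProduct f)
        (fun x => T x - ∑ i, PiLp.single 2 i (T' i (x i))) (Set.univ.pi U) := by
  intro x₀
  obtain ⟨T', hT', htriv⟩ := mainTheorem5_general g f hf x₀
    (InfBending.affineSpan_extrinsicProduct_image_connectedComponent hf (hfull x₀)) T hT hβ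
  exact ⟨_, T', fun _ => mem_connectedComponent, fun i => (hT' i).mono
    (InfBending.isOpen_connectedComponent_of_chartedSpace (EuclideanSpace ℝ (Fin (n i))) (x₀ i))
    (Set.subset_univ _), htriv⟩
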